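/- Let $q\in\mathbb{C}$ with $|q|<1$. For $a,x\in\mathbb{C}$ with $|x|<1$ and an integer $n\ge 0$ write $(a;x)_n=\prod_{k=0}^{n-1}(1-ax^k)$ (so $(a;x)_0=1$) and $(a;x)_\infty=\prod_{k=0}^{\infty}(1-ax^k)$. Then the series below converges and $$\sum_{n=0}^{\infty}\frac{(-1;q)_{2n}\,q^{n^2+n}}{(q^2;q^2)_n\,(q^2;q^4)_n}=\frac{(-q^3;q^6)_\infty^2\,(q^6;q^6)_\infty\,(-q^2;q^2)_\infty}{(q^2;q^2)_\infty}.$$ -/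

import Mathlib

/-- The finite `q`-shifted factorial `(a;q)_n = ∏_{k=0}^{n-1} (1 - a q^k)`. -/
def qPoch (a q : ℂ) (n : ℕ) : ℂ :=
  ∏ k ∈ Finset.range n, (1 - a * q ^ k)

/-- The infinite `q`-shifted factorial `(a;q)_∞ = ∏_{k=0}^∞ (1 - a q^k)`, used for `‖q‖ < 1`. -/
noncomputable def qPochInf (a q : ℂ) : ℂ :=
  ∏' k : ℕ, (1 - a * q ^ k)

/-- The product defining `(a;q)_∞` converges for every `a` when `‖q‖ < 1`. -/
theorem hasProd_qPochInf (a : ℂ) {q : ℂ} (hq : ‖q‖ < 1) :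
    HasProd (fun k : ℕ => 1 - a * q ^ k) (qPochInf a q) := by
  have hs : Summable (fun k : ℕ => ‖-(a * q ^ k)‖) := by
    simp only [norm_neg, norm_mul, norm_pow]
    exact (summable_geometric_of_lt_one (norm_nonneg q) hq).mul_left ‖a‖
  have h := (multipliable_one_add_of_summable hs).hasProd
  simpa [qPochInf, sub_eq_add_neg] using h

open Filter Topology

/-! This is a Bailey pair argument with base q². After cancelling (-q;q²)_n the summand is (-1;q²)_n
q^(n²+n) / (q;q)_{2n} (`qPoch_term_eq`). The Bailey pair `sum_baileyAlpha` expands 1/(q;q)_{2n} over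
r ≤ n, giving an absolutely convergent double series in r and m = n - r. For fixed r the sum over m
is a ₁φ₁, evaluated by `hasSum_phiTerm`; up to a factor free of r it equals 1 for r = 0 and 2q^(3r²)
otherwise. The remaining theta series in q³ is a product by `hasSum_pow_sq`. -/

/-! ### q-shifted factorials: recurrences, limits and bounds -/

theorem qPoch_zero (a q : ℂ) : qPoch a q 0 = 1 := by simp [qPoch]

theorem qPoch_succ (a q : ℂ) (n : ℕ) : qPoch a q (n + 1) = qPoch a q n * (1 - a * q ^ n) := by
  simp [qPoch, Finset.prod_range_succ]

theorem qPoch_add (a q : ℂ) (m n : ℕ) :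
    qPoch a q (m + n) = qPoch a q m * qPoch (a * q ^ m) q n := by
  simp [qPoch, Finset.prod_range_add, pow_add, mul_assoc]

theorem qPoch_succ' (a q : ℂ) (n : ℕ) : qPoch a q (n + 1) = (1 - a) * qPoch (a * q) q n := by
  rw [add_comm, qPoch_add]; simp [qPoch]

theorem one_sub_mul_pow_ne_zero {a q : ℂ} (ha : ‖a‖ < 1) (hq : ‖q‖ < 1) (k : ℕ) :
    1 - a * q ^ k ≠ 0 := by
  intro h
  have h1 : ‖a * q ^ k‖ = 1 := by rw [← sub_eq_zero.mp h]; simp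
  have h2 : ‖a * q ^ k‖ ≤ ‖a‖ := by
    rw [norm_mul, norm_pow]
    exact mul_le_of_le_one_right (norm_nonneg _) (pow_le_one₀ (norm_nonneg _) hq.le)
  linarith

theorem qPoch_ne_zero {a q : ℂ} (ha : ‖a‖ < 1) (hq : ‖q‖ < 1) (n : ℕ) : qPoch a q n ≠ 0 :=
  Finset.prod_ne_zero_iff.mpr fun k _ => one_sub_mul_pow_ne_zero ha hq k

theorem tendsto_qPoch (a : ℂ) {q : ℂ} (hq : ‖q‖ < 1) :
    Tendsto (qPoch a q) atTop (𝓝 (qPochInf a q)) :=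
  (hasProd_qPochInf a hq).tendsto_prod_nat

theorem qPochInf_eq_mul (a : ℂ) {q : ℂ} (hq : ‖q‖ < 1) (m : ℕ) :
    qPochInf a q = qPoch a q m * qPochInf (a * q ^ m) q := by
  have h1 := (tendsto_qPoch a hq).comp (tendsto_add_atTop_nat m)
  have h2 := (tendsto_qPoch (a * q ^ m) hq).const_mul (qPoch a q m)
  refine tendsto_nhds_unique h1 (h2.congr fun n => ?_)
  simp [← qPoch_add, add_comm]

theorem qPochInf_ne_zero {a q : ℂ} (ha : ‖a‖ < 1) (hq : ‖q‖ < 1) : qPochInf a q ≠ 0 := by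
  have hs : Summable (fun k : ℕ => ‖-(a * q ^ k)‖) := by
    simp only [norm_neg, norm_mul, norm_pow]
    exact (summable_geometric_of_lt_one (norm_nonneg q) hq).mul_left ‖a‖
  have h := tprod_one_add_ne_zero_of_summable (f := fun k : ℕ => -(a * q ^ k))
    (fun k => by simpa [sub_eq_add_neg] using one_sub_mul_pow_ne_zero ha hq k) hs
  simpa [qPochInf, sub_eq_add_neg] using h

theorem exists_norm_qPoch_le (a : ℂ) {q : ℂ} (hq : ‖q‖ < 1) :
    ∃ C : ℝ, 0 < C ∧ ∀ n, ‖qPoch a q n‖ ≤ C := by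
  obtain ⟨C, hC⟩ := (tendsto_qPoch a hq).norm.bddAbove_range
  exact ⟨max C 1, by positivity, fun n => (hC ⟨n, rfl⟩).trans (le_max_left _ _)⟩

theorem exists_norm_inv_qPoch_le {a q : ℂ} (ha : ‖a‖ < 1) (hq : ‖q‖ < 1) :
    ∃ C : ℝ, 0 < C ∧ ∀ n, ‖(qPoch a q n)⁻¹‖ ≤ C := by
  obtain ⟨C, hC⟩ := ((tendsto_qPoch a hq).inv₀ (qPochInf_ne_zero ha hq)).norm.bddAbove_range
  exact ⟨max C 1, by positivity, fun n => (hC ⟨n, rfl⟩).trans (le_max_left _ _)⟩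

/-! ### Gaussian binomials and finite summations -/

/-- The Gaussian binomial coefficient, defined by the `q`-Pascal rule. -/
def gaussBinom (q : ℂ) : ℕ → ℕ → ℂ
  | _, 0 => 1
  | 0, _ + 1 => 0
  | n + 1, k + 1 => gaussBinom q n k + q ^ (k + 1) * gaussBinom q n (k + 1)

theorem gaussBinom_zero_right (q : ℂ) (n : ℕ) : gaussBinom q n 0 = 1 := by
  cases n <;> rfl

theorem gaussBinom_succ_succ (q : ℂ) (n k : ℕ) :
    gaussBinom q (n + 1) (k + 1) = gaussBinom q n k + q ^ (k + 1) * gaussBinom q n (k + 1) := rfl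

theorem gaussBinom_eq_zero (q : ℂ) {n k : ℕ} (h : n < k) : gaussBinom q n k = 0 := by
  induction n generalizing k with
  | zero => obtain ⟨k, rfl⟩ := Nat.exists_eq_succ_of_ne_zero h.ne'; rfl
  | succ n ih =>
    obtain ⟨k, rfl⟩ := Nat.exists_eq_succ_of_ne_zero (Nat.ne_of_gt (Nat.zero_lt_of_lt h))
    rw [Nat.succ_eq_add_one, gaussBinom_succ_succ, ih (by omega), ih (by omega)]; simp

theorem gaussBinom_mul_qPoch (q : ℂ) (i j : ℕ) :
    gaussBinom q (i + j) i * (qPoch q q i * qPoch q q j) = qPoch q q (i + j) := by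
  induction h : i + j generalizing i j with
  | zero =>
    obtain ⟨rfl, rfl⟩ : i = 0 ∧ j = 0 := by omega
    simp [qPoch, gaussBinom]
  | succ n ih =>
    rcases i with _ | i
    · obtain rfl : j = n + 1 := by omega
      simp [qPoch_zero, gaussBinom_zero_right]
    rcases j with _ | j
    · obtain rfl : i = n := by omega
      have := ih i 0 rfl
      rw [gaussBinom_succ_succ, gaussBinom_eq_zero q (Nat.lt_succ_self i), qPoch_succ q q i]
      linear_combination (1 - q * q ^ i) * this
    · have h1 := ih i (j + 1) (by omega)
      have h2 := ih (i + 1) j (by omega)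
      obtain rfl : n = i + j + 1 := by omega
      rw [gaussBinom_succ_succ, qPoch_succ q q (i + j + 1)]
      rw [qPoch_succ] at h1 h2 ⊢
      rw [qPoch_succ q q j]  at *
      linear_combination (1 - q * q ^ i) * h1 + q ^ (i + 1) * (1 - q * q ^ j) * h2

theorem gaussBinom_eq_div {q : ℂ} (hq : ‖q‖ < 1) (i j : ℕ) :
    gaussBinom q (i + j) i = qPoch q q (i + j) / (qPoch q q i * qPoch q q j) :=
  eq_div_of_mul_eq (mul_ne_zero (qPoch_ne_zero hq hq i) (qPoch_ne_zero hq hq j))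
    (gaussBinom_mul_qPoch q i j)

theorem gaussBinom_symm {q : ℂ} (hq : ‖q‖ < 1) {n k : ℕ} (h : k ≤ n) :
    gaussBinom q n (n - k) = gaussBinom q n k := by
  obtain ⟨j, rfl⟩ := Nat.exists_eq_add_of_le h
  rw [gaussBinom_eq_div hq, Nat.add_sub_cancel_left, add_comm k j, gaussBinom_eq_div hq, mul_comm]

/-- Summation by the `q`-Pascal rule. -/
theorem sum_gaussBinom_succ (q : ℂ) (n : ℕ) (f : ℕ → ℂ) :
    ∑ k ∈ Finset.range (n + 2), gaussBinom q (n + 1) k * f k =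
      (∑ k ∈ Finset.range (n + 1), gaussBinom q n k * f (k + 1)) +
        ∑ k ∈ Finset.range (n + 1), gaussBinom q n k * (q ^ k * f k) := by
  have h : ∑ k ∈ Finset.range (n + 1), gaussBinom q n k * (q ^ k * f k) =
      ∑ k ∈ Finset.range (n + 2), gaussBinom q n k * (q ^ k * f k) := by
    rw [Finset.sum_range_succ _ (n + 1), gaussBinom_eq_zero q (Nat.lt_succ_self n)]; simp
  rw [h, Finset.sum_range_succ', Finset.sum_range_succ' _ (n + 1), ← add_assoc,
    ← Finset.sum_add_distrib]
  simp only [gaussBinom_zero_right, gaussBinom_succ_succ]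
  congr 1
  · exact Finset.sum_congr rfl fun k _ => by ring
  · simp

/-- The finite `q`-binomial theorem. -/
theorem sum_gaussBinom_mul_pow (q x : ℂ) (n : ℕ) :
    ∑ k ∈ Finset.range (n + 1), gaussBinom q n k * (q ^ (k.choose 2) * x ^ k) =
      qPoch (-x) q n := by
  induction n generalizing x with
  | zero => simp [gaussBinom, qPoch]
  | succ n ih =>
    have h := ih (x * q)
    rw [sum_gaussBinom_succ, qPoch_succ', neg_mul, ← h, Finset.mul_sum, ← Finset.sum_add_distrib]
    refine Finset.sum_congr rfl fun k _ => ?_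
    rw [Nat.choose_succ_succ' k 1, Nat.choose_one_right]
    ring

/-- The q-Pascal rule splits the sum for n + 1 in two: the first part is the sum for n reflected by
k ↦ n - k, the second is q^(n+1) times it. Even orders, folded about the centre, yield the Bailey
pair. -/
theorem sum_gaussBinom_triangular {q : ℂ} (hq : ‖q‖ < 1) (h0 : q ≠ 0) (n : ℕ) :
    ∑ k ∈ Finset.range (n + 1),
      gaussBinom (q ^ 2) n k * q ^ (((n : ℤ) - 2 * k) * ((n : ℤ) - 2 * k + 1) / 2) =
      qPoch (-q) q n := by
  have hq2 : ‖q ^ 2‖ < 1 := by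
    rw [norm_pow]; exact pow_lt_one₀ (norm_nonneg _) hq two_ne_zero
  induction n with
  | zero => simp [gaussBinom, qPoch]
  | succ n ih =>
    rw [sum_gaussBinom_succ, qPoch_succ, mul_sub, mul_one, sub_eq_add_neg]
    congr 1
    · rw [← ih, ← Finset.sum_range_reflect]
      refine Finset.sum_congr rfl fun k hk => ?_
      have hk' : k ≤ n := Nat.lt_succ_iff.mp (Finset.mem_range.mp hk)
      rw [Nat.add_sub_cancel, gaussBinom_symm hq2 hk']
      congr 3
      push_cast [Nat.cast_sub hk']
      ring
    · rw [← ih, neg_mul, mul_neg, neg_neg, Finset.sum_mul]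
      refine Finset.sum_congr rfl fun k _ => ?_
      rw [mul_assoc]
      congr 1
      have e : (((n + 1 : ℕ) : ℤ) - 2 * k) * (((n + 1 : ℕ) : ℤ) - 2 * k + 1) / 2 =
          ((n : ℤ) - 2 * k) * ((n : ℤ) - 2 * k + 1) / 2 + ((n : ℤ) + 1 - 2 * k) := by
        rw [← Int.add_mul_ediv_right _ _ two_ne_zero]
        congr 1
        push_cast
        ring
      rw [e, zpow_add₀ h0, ← pow_mul, ← pow_succ', ← zpow_natCast, ← zpow_natCast, mul_left_comm,
        ← zpow_add₀ h0]
      congr 2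
      push_cast
      ring

theorem sum_range_two_mul_add_one (n : ℕ) (f : ℕ → ℂ) :
    ∑ k ∈ Finset.range (2 * n + 1), f k =
      f n + ∑ r ∈ Finset.range n, (f (n + (r + 1)) + f (n - (r + 1))) := by
  rw [Finset.sum_add_distrib, show 2 * n + 1 = n + (n + 1) by ring, Finset.sum_range_add,
    Finset.sum_range_succ', ← Finset.sum_range_reflect f n]
  simp only [add_zero, Nat.sub_sub, add_comm 1]
  ring

/-- A symmetric sum over Gaussian binomials of even order, folded about the centre. -/
theorem sum_gaussBinom_fold {q : ℂ} (hq : ‖q‖ < 1) (n : ℕ) (f : ℤ → ℂ) :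
    ∑ k ∈ Finset.range (2 * n + 1), gaussBinom q (2 * n) k * f ((n : ℤ) - k) =
      ∑ r ∈ Finset.range (n + 1), (if r = 0 then f 0 else f r + f (-r)) *
        (qPoch q q (2 * n) / (qPoch q q (n - r) * qPoch q q (n + r))) := by
  rw [sum_range_two_mul_add_one, Finset.sum_range_succ', add_comm]
  congr 1
  · refine Finset.sum_congr rfl fun r hr => ?_
    have hr' : r + 1 ≤ n := Finset.mem_range.mp hr
    have e := gaussBinom_eq_div hq (n - (r + 1)) (n + (r + 1))
    rw [show n - (r + 1) + (n + (r + 1)) = 2 * n by omega] at e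
    have e' : gaussBinom q (2 * n) (n + (r + 1)) = gaussBinom q (2 * n) (n - (r + 1)) := by
      rw [← gaussBinom_symm hq (show n - (r + 1) ≤ 2 * n by omega)]
      congr 1; omega
    rw [if_neg (Nat.succ_ne_zero r), e', e]
    push_cast [Nat.cast_sub hr']
    rw [show (n : ℤ) - (n + (r + 1)) = -(r + 1) by ring, show (n : ℤ) - (n - (r + 1)) = r + 1 by ring]
    ring
  · have e := gaussBinom_eq_div hq n n
    rw [← two_mul] at e
    rw [if_pos rfl, e, sub_self, Nat.sub_zero, Nat.add_zero, mul_comm]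

/-! ### Theta series: finite form and limit -/

theorem qPoch_zpow_one_sub {q : ℂ} (h0 : q ≠ 0) (n : ℕ) :
    q ^ (n ^ 2) * qPoch (-q ^ (1 - 2 * (n : ℤ))) (q ^ 2) n = qPoch (-q) (q ^ 2) n := by
  induction n with
  | zero => simp [qPoch]
  | succ n ih =>
    have e : -q ^ (1 - 2 * ((n + 1 : ℕ) : ℤ)) * q ^ 2 = -q ^ (1 - 2 * (n : ℤ)) := by
      rw [neg_mul, ← zpow_natCast q 2, ← zpow_add₀ h0]
      congr 2
      push_cast
      ring
    have e2 : q ^ (2 * n + 1) * q ^ (1 - 2 * ((n + 1 : ℕ) : ℤ)) = 1 := by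
      rw [← zpow_natCast q, ← zpow_add₀ h0, ← zpow_zero q]
      congr 1
      push_cast
      ring
    rw [qPoch_succ', e, qPoch_succ, ← ih]
    linear_combination q ^ (n ^ 2) * qPoch (-q ^ (1 - 2 * (n : ℤ))) (q ^ 2) n * e2

/-- A finite triple product: the q-binomial theorem at x = q^(1-2n) in base q². The product of 2n
factors splits into halves, and q^(n²) turns the half with negative exponents into a second
(-q;q²)_n. -/
theorem sum_gaussBinom_sq {q : ℂ} (h0 : q ≠ 0) (n : ℕ) :
    ∑ k ∈ Finset.range (2 * n + 1), gaussBinom (q ^ 2) (2 * n) k * q ^ (((n : ℤ) - k) ^ 2) =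
      qPoch (-q) (q ^ 2) n ^ 2 := by
  have e : -q ^ (1 - 2 * (n : ℤ)) * (q ^ 2) ^ n = -q := by
    rw [neg_mul, ← pow_mul, ← zpow_natCast, ← zpow_add₀ h0]
    push_cast
    simp
  have h := sum_gaussBinom_mul_pow (q ^ 2) (q ^ (1 - 2 * (n : ℤ))) (2 * n)
  rw [two_mul n, qPoch_add, e, ← two_mul] at h
  rw [sq (qPoch _ _ _)]
  nth_rw 1 [← qPoch_zpow_one_sub h0 n]
  rw [mul_assoc, ← h, Finset.mul_sum]
  refine Finset.sum_congr rfl fun k _ => ?_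
  have hk : ((k * (k - 1) : ℕ) : ℤ) = k * (k - 1) := by
    rcases k with _ | k <;> simp
  have h2 : 2 * k.choose 2 = k * (k - 1) := by
    rw [Nat.choose_two_right, Nat.mul_div_cancel' (Nat.even_mul_pred_self k).two_dvd]
  rw [mul_left_comm]
  congr 1
  rw [← pow_mul, h2, ← zpow_natCast q, ← zpow_natCast q, ← zpow_natCast (q ^ _) k, ← zpow_mul,
    ← zpow_add₀ h0, ← zpow_add₀ h0, hk]
  congr 1
  push_cast
  ring

theorem norm_sq_lt_one {q : ℂ} (hq : ‖q‖ < 1) : ‖q ^ 2‖ < 1 := by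
  rw [norm_pow]; exact pow_lt_one₀ (norm_nonneg _) hq two_ne_zero

/-- Gauss's case of the Jacobi triple product identity, with the series folded about `0`. -/
theorem hasSum_pow_sq {q : ℂ} (hq : ‖q‖ < 1) (h0 : q ≠ 0) :
    HasSum (fun r : ℕ => if r = 0 then (1 : ℂ) else 2 * q ^ (r ^ 2))
      (qPochInf (-q) (q ^ 2) ^ 2 * qPochInf (q ^ 2) (q ^ 2)) := by
  set β : ℕ → ℂ := fun r => if r = 0 then (1 : ℂ) else 2 * q ^ (r ^ 2) with hβ
  have hq2 := norm_sq_lt_one hq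
  have hβn (r : ℕ) : ‖β r‖ ≤ 2 * ‖q‖ ^ r := by
    rcases r with _ | r
    · simp [hβ]
    · simp only [hβ, if_neg (Nat.succ_ne_zero r), norm_mul, norm_pow, Complex.norm_ofNat]
      gcongr 2 * ?_
      exact pow_le_pow_of_le_one (norm_nonneg _) hq.le (Nat.le_self_pow two_ne_zero _)
  have hgeo : Summable fun r : ℕ => 2 * ‖q‖ ^ r :=
    (summable_geometric_of_lt_one (norm_nonneg q) hq).mul_left 2
  have hsum : Summable β := Summable.of_norm_bounded hgeo hβn
  obtain ⟨C, hC0, hC⟩ := exists_norm_qPoch_le (q ^ 2) hq2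
  obtain ⟨D, hD0, hD⟩ := exists_norm_inv_qPoch_le hq2 hq2
  -- Summands of the folded finite identity, extended by zero so that dominated convergence applies
  -- as n → ∞.
  set F : ℕ → ℕ → ℂ := fun n r => if r ≤ n then β r * (qPoch (q ^ 2) (q ^ 2) (2 * n) *
    ((qPoch (q ^ 2) (q ^ 2) (n - r))⁻¹ * (qPoch (q ^ 2) (q ^ 2) (n + r))⁻¹)) else 0 with hF
  have hP := qPochInf_ne_zero hq2 hq2
  have hlim : Tendsto (fun n => ∑' r, F n r) atTop
      (𝓝 (∑' r, β r * (qPochInf (q ^ 2) (q ^ 2))⁻¹)) := by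
    refine tendsto_tsum_of_dominated_convergence (bound := fun r => 2 * ‖q‖ ^ r * (C * (D * D)))
      (hgeo.mul_right _) (fun r => ?_) (Eventually.of_forall fun n r => ?_)
    · have hT := tendsto_qPoch (q ^ 2) hq2
      have t1 : Tendsto (fun n : ℕ => 2 * n) atTop atTop :=
        tendsto_atTop_mono (fun n => Nat.le_mul_of_pos_left n two_pos) tendsto_id
      have t := (hT.comp t1).mul
        (((hT.comp (tendsto_sub_atTop_nat r)).inv₀ hP).mul
          ((hT.comp (tendsto_add_atTop_nat r)).inv₀ hP))
      have t' := t.const_mul (β r)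
      rw [mul_inv_cancel_left₀ hP] at t'
      refine t'.congr' ?_
      filter_upwards [eventually_ge_atTop r] with n hn
      simp [hF, hn]
    · by_cases h : r ≤ n
      · simp only [hF, if_pos h, norm_mul]
        gcongr
        exacts [hβn r, hC _, hD _, hD _]
      · simp only [hF, if_neg h, norm_zero]
        positivity
  have hfin (n : ℕ) : ∑' r, F n r = qPoch (-q) (q ^ 2) n ^ 2 := by
    rw [← sum_gaussBinom_sq h0, sum_gaussBinom_fold hq2 n (fun z : ℤ => q ^ (z ^ 2)),
      tsum_eq_sum (s := Finset.range (n + 1))]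
    · refine Finset.sum_congr rfl fun r hr => ?_
      rw [hF]
      simp only [if_pos (Nat.lt_succ_iff.mp (Finset.mem_range.mp hr)), div_eq_mul_inv, mul_inv]
      congr 1
      rcases r with _ | r
      · simp [hβ]
      · simp only [hβ, if_neg (Nat.succ_ne_zero r), neg_sq, two_mul]
        norm_cast
    · intro r hr
      have : ¬ r ≤ n := fun h => hr (Finset.mem_range.mpr (by omega))
      simp [hF, this]
  have h := tendsto_nhds_unique (hlim.congr hfin) ((tendsto_qPoch (-q) hq2).pow 2)
  rw [tsum_mul_right] at h
  rw [← h, inv_mul_cancel_right₀ hP]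
  exact hsum.hasSum

/-! ### Summation of the ₁φ₁ series -/

/-- The general term of the series `₁φ₁(a; ab; q, b)`. -/
noncomputable def phiTerm (a q b : ℂ) (m : ℕ) : ℂ :=
  qPoch a q m * (-b) ^ m * q ^ (m.choose 2) / (qPoch q q m * qPoch (a * b) q m)

theorem summable_phiTerm {a b q : ℂ} (hq : ‖q‖ < 1) (hb : ‖b‖ < 1) (hab : ‖a * b‖ < 1) :
    Summable (phiTerm a q b) := by
  obtain ⟨C, hC0, hC⟩ := exists_norm_qPoch_le a hq
  obtain ⟨D, hD0, hD⟩ := exists_norm_inv_qPoch_le hq hq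
  obtain ⟨E, hE0, hE⟩ := exists_norm_inv_qPoch_le hab hq
  refine Summable.of_norm_bounded (g := fun m => C * ‖b‖ ^ m * 1 * (D * E))
    ((((summable_geometric_of_lt_one (norm_nonneg b) hb).mul_left C).mul_right 1).mul_right _)
    fun m => ?_
  rw [phiTerm, div_eq_mul_inv, mul_inv]
  simp only [norm_mul, norm_pow, norm_neg]
  gcongr
  exacts [hC m, pow_le_one₀ (norm_nonneg _) hq.le, hD m, hE m]

/-- The difference of the two sides telescopes: `hpart` gives its partial sums in closed form, and
they tend to 0. -/
theorem tsum_phiTerm_mul {a b q : ℂ} (hq : ‖q‖ < 1) (hb : ‖b‖ < 1) (hab : ‖a * b‖ < 1) :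
    (1 - a * b) * ∑' m, phiTerm a q b m = (1 - b) * ∑' m, phiTerm a q (b * q) m := by
  have le {x : ℂ} (hx : ‖x‖ < 1) : ‖x * q‖ < 1 := by
    rw [norm_mul]; exact mul_lt_one_of_nonneg_of_lt_one_left (norm_nonneg _) hx hq.le
  have habq : ‖a * (b * q)‖ < 1 := by rw [← mul_assoc]; exact le hab
  have s1 := summable_phiTerm hq hb hab
  have s2 := summable_phiTerm hq (le hb) habq
  have hd := (s1.mul_left (1 - a * b)).sub (s2.mul_left (1 - b))
  have hpart (M : ℕ) : ∑ m ∈ Finset.range (M + 1),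
      ((1 - a * b) * phiTerm a q b m - (1 - b) * phiTerm a q (b * q) m) =
      b * (phiTerm a q (b * q) M - a * (q ^ M * phiTerm a q (b * q) M)) := by
    induction M with
    | zero => simp [phiTerm, qPoch]; ring
    | succ M ih =>
      rw [Finset.sum_range_succ, ih]
      have n1 := qPoch_ne_zero hq hq M
      have n2 := qPoch_ne_zero habq hq M
      have n3 := one_sub_mul_pow_ne_zero hq hq M
      have n4 := one_sub_mul_pow_ne_zero habq hq M
      have n5 : 1 - a * b ≠ 0 := by simpa using one_sub_mul_pow_ne_zero hab hq 0
      simp only [phiTerm]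
      rw [qPoch_succ' (a * b), mul_assoc a b q, qPoch_succ a, qPoch_succ q, qPoch_succ (a * (b * q)),
        Nat.choose_succ_succ' M 1, Nat.choose_one_right, neg_pow (b * q) M, neg_pow b (M + 1),
        neg_pow (b * q) (M + 1), mul_pow, mul_pow, pow_add q M, pow_succ q, pow_succ b, pow_succ]
      clear ih
      generalize qPoch (a * (b * q)) q M = P at n2 ⊢
      generalize q ^ M = x at n3 n4 ⊢
      generalize hu : 1 - q * x = u at n3 ⊢
      generalize hv : 1 - a * (b * q) * x = v at n4 ⊢
      generalize hw : 1 - a * b = w at n5 ⊢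
      field_simp
      rw [← hu, ← hv]
      ring
  have h0 := s2.tendsto_atTop_zero
  have hlim : Tendsto (fun M => b * (phiTerm a q (b * q) M - a * (q ^ M * phiTerm a q (b * q) M)))
      atTop (𝓝 (b * (0 - a * (0 * 0)))) :=
    (h0.sub (((tendsto_pow_atTop_nhds_zero_of_norm_lt_one hq).mul h0).const_mul a)).const_mul b
  have h := tendsto_nhds_unique
    (((hd.hasSum.tendsto_sum_nat).comp (tendsto_add_atTop_nat 1)).congr hpart) hlim
  rw [(s1.mul_left _).tsum_sub (s2.mul_left _), tsum_mul_left, tsum_mul_left] at h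
  linear_combination h

theorem tsum_phiTerm_mul_qPoch {a b q : ℂ} (hq : ‖q‖ < 1) (hb : ‖b‖ < 1) (hab : ‖a * b‖ < 1)
    (k : ℕ) :
    qPoch (a * b) q k * ∑' m, phiTerm a q b m = qPoch b q k * ∑' m, phiTerm a q (b * q ^ k) m := by
  induction k with
  | zero => simp [qPoch]
  | succ k ih =>
    have le {x : ℂ} (hx : ‖x‖ < 1) : ‖x * q ^ k‖ < 1 := by
      rw [norm_mul, norm_pow]
      exact mul_lt_one_of_nonneg_of_lt_one_left (norm_nonneg _) hx
        (pow_le_one₀ (norm_nonneg _) hq.le)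
    have h := tsum_phiTerm_mul hq (le hb) (a := a) (by rw [← mul_assoc]; exact le hab)
    rw [qPoch_succ, qPoch_succ, pow_succ, ← mul_assoc b]
    linear_combination (1 - a * b * q ^ k) * ih + qPoch b q k * h

/-- The `q`-analogue of Gauss's summation, confluent case. -/
theorem hasSum_phiTerm {a b q : ℂ} (hq : ‖q‖ < 1) (hb : ‖b‖ < 1) (hab : ‖a * b‖ < 1) :
    HasSum (phiTerm a q b) (qPochInf b q / qPochInf (a * b) q) := by
  obtain ⟨C, hC0, hC⟩ := exists_norm_qPoch_le a hq
  obtain ⟨D, hD0, hD⟩ := exists_norm_inv_qPoch_le hq hq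
  obtain ⟨E, hE0, hE⟩ := exists_norm_inv_qPoch_le hab hq
  obtain ⟨G, hG0, hG⟩ := exists_norm_qPoch_le (a * b) hq
  -- Bounds uniform in k, from (abq^k;q)_m = (ab;q)_{k+m} / (ab;q)_k; they allow b q^k → 0 inside
  -- the sum.
  have hE' (k m : ℕ) : ‖(qPoch (a * (b * q ^ k)) q m)⁻¹‖ ≤ G * E := by
    have e : (qPoch (a * (b * q ^ k)) q m)⁻¹ = qPoch (a * b) q k * (qPoch (a * b) q (k + m))⁻¹ := by
      rw [qPoch_add, mul_inv, mul_inv_cancel_left₀ (qPoch_ne_zero hab hq k), mul_assoc]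
    rw [e, norm_mul]
    gcongr
    exacts [hG k, hE _]
  have hbk (k m : ℕ) : ‖(-(b * q ^ k)) ^ m‖ ≤ ‖b‖ ^ m := by
    rw [norm_pow, norm_neg, norm_mul, norm_pow]
    gcongr
    exact mul_le_of_le_one_right (norm_nonneg _) (pow_le_one₀ (norm_nonneg _) hq.le)
  have hqk : Tendsto (fun k : ℕ => b * q ^ k) atTop (𝓝 0) := by
    simpa using (tendsto_pow_atTop_nhds_zero_of_norm_lt_one hq).const_mul b
  have hlim : Tendsto (fun k => ∑' m, phiTerm a q (b * q ^ k) m) atTop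
      (𝓝 (∑' m, phiTerm a q 0 m)) := by
    refine tendsto_tsum_of_dominated_convergence
      (bound := fun m => C * ‖b‖ ^ m * 1 * (D * (G * E)))
      ((((summable_geometric_of_lt_one (norm_nonneg b) hb).mul_left C).mul_right 1).mul_right _)
      (fun m => ?_) (Eventually.of_forall fun k m => ?_)
    · have hc : ContinuousAt (fun x => phiTerm a q x m) 0 := by
        unfold phiTerm
        refine ContinuousAt.div ?_ ?_ ?_
        · fun_prop
        · unfold qPoch; fun_prop
        · simpa [qPoch] using qPoch_ne_zero hq hq m
      exact hc.tendsto.comp hqk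
    · rw [phiTerm, div_eq_mul_inv, mul_inv]
      simp only [norm_mul]
      gcongr
      · exact hC m
      · exact hbk k m
      · rw [norm_pow]; exact pow_le_one₀ (norm_nonneg _) hq.le
      · exact hD m
      · exact hE' k m
  have h1 : ∑' m, phiTerm a q 0 m = 1 := by
    rw [tsum_eq_single 0]
    · simp [phiTerm, qPoch]
    · intro m hm
      simp [phiTerm, hm]
  rw [h1] at hlim
  have h := tendsto_nhds_unique
    (((tendsto_qPoch (a * b) hq).mul_const _).congr fun k => tsum_phiTerm_mul_qPoch hq hb hab k)
    ((tendsto_qPoch b hq).mul hlim)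
  rw [mul_one] at h
  rw [← h, mul_div_cancel_left₀ _ (qPochInf_ne_zero hab hq)]
  exact (summable_phiTerm hq hb hab).hasSum

/-! ### The Bailey pair -/

theorem qPoch_two_mul (a q : ℂ) (n : ℕ) :
    qPoch a q (2 * n) = qPoch a (q ^ 2) n * qPoch (a * q) (q ^ 2) n := by
  induction n with
  | zero => simp [qPoch]
  | succ n ih =>
    rw [mul_add, mul_one, qPoch_succ, qPoch_succ, ih, qPoch_succ, qPoch_succ]
    ring

theorem qPoch_mul_qPoch_neg (a q : ℂ) (n : ℕ) :
    qPoch a q n * qPoch (-a) q n = qPoch (a ^ 2) (q ^ 2) n := by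
  rw [qPoch, qPoch, qPoch, ← Finset.prod_mul_distrib]
  exact Finset.prod_congr rfl fun k _ => by ring

theorem qPoch_term_eq {q : ℂ} (hq : ‖q‖ < 1) (n : ℕ) (c : ℂ) :
    qPoch (-1) q (2 * n) * c / (qPoch (q ^ 2) (q ^ 2) n * qPoch (q ^ 2) (q ^ 4) n) =
      qPoch (-1) (q ^ 2) n * c * (qPoch q q (2 * n))⁻¹ := by
  have hq2 := norm_sq_lt_one hq
  have n1 := qPoch_ne_zero hq hq2 n
  have n2 := qPoch_ne_zero (a := -q) (by rwa [norm_neg]) hq2 n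
  have n3 := qPoch_ne_zero hq2 hq2 n
  rw [show q ^ 4 = (q ^ 2) ^ 2 by ring, ← qPoch_mul_qPoch_neg q (q ^ 2), qPoch_two_mul,
    qPoch_two_mul, ← sq, neg_one_mul]
  field_simp

/-- The first member, with respect to the base `q ^ 2`, of the Bailey pair whose second member is
`1 / (q;q)_{2n}`. -/
def baileyAlpha (q : ℂ) (r : ℕ) : ℂ :=
  if r = 0 then 1 else q ^ (r * (2 * r + 1)) + q ^ (r * (2 * r - 1))

/-- Multiplied by (q²;q²)_{2n}, the left side is the folded triangular sum (-q;q)_{2n}, and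
(q;q)_{2n} (-q;q)_{2n} = (q²;q²)_{2n}. -/
theorem sum_baileyAlpha {q : ℂ} (hq : ‖q‖ < 1) (h0 : q ≠ 0) (n : ℕ) :
    ∑ r ∈ Finset.range (n + 1), baileyAlpha q r *
      ((qPoch (q ^ 2) (q ^ 2) (n - r))⁻¹ * (qPoch (q ^ 2) (q ^ 2) (n + r))⁻¹) =
      (qPoch q q (2 * n))⁻¹ := by
  have hq2 := norm_sq_lt_one hq
  have h := sum_gaussBinom_triangular hq h0 (2 * n)
  have e (k : ℕ) : (((2 * n : ℕ) : ℤ) - 2 * k) * (((2 * n : ℕ) : ℤ) - 2 * k + 1) / 2 =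
      ((n : ℤ) - k) * (2 * ((n : ℤ) - k) + 1) :=
    Int.ediv_eq_of_eq_mul_left two_ne_zero (by push_cast; ring)
  simp only [e] at h
  rw [sum_gaussBinom_fold hq2 n (fun z : ℤ => q ^ (z * (2 * z + 1)))] at h
  have n2 := qPoch_ne_zero hq2 hq2 (2 * n)
  have hα (r : ℕ) : baileyAlpha q r = if r = 0 then q ^ ((0 : ℤ) * (2 * 0 + 1)) else
      q ^ ((r : ℤ) * (2 * r + 1)) + q ^ ((-r : ℤ) * (2 * -r + 1)) := by
    rcases r with _ | r
    · simp [baileyAlpha]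
    · simp only [baileyAlpha, if_neg (Nat.succ_ne_zero r), ← zpow_natCast]
      rw [show 2 * (r + 1) - 1 = 2 * r + 1 by omega]
      congr 2
  refine eq_inv_of_mul_eq_one_left ?_
  refine mul_right_cancel₀ n2 ?_
  have hsum : (∑ r ∈ Finset.range (n + 1), baileyAlpha q r *
      ((qPoch (q ^ 2) (q ^ 2) (n - r))⁻¹ * (qPoch (q ^ 2) (q ^ 2) (n + r))⁻¹)) *
      qPoch (q ^ 2) (q ^ 2) (2 * n) = qPoch (-q) q (2 * n) := by
    rw [← h, Finset.sum_mul]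
    refine Finset.sum_congr rfl fun r _ => ?_
    rw [hα, div_eq_mul_inv, mul_inv]
    ring
  linear_combination qPoch q q (2 * n) * hsum + qPoch_mul_qPoch_neg q q (2 * n)

theorem norm_baileyAlpha_le {q : ℂ} (hq : ‖q‖ ≤ 1) (r : ℕ) : ‖baileyAlpha q r‖ ≤ 2 := by
  unfold baileyAlpha
  split_ifs
  · simp
  · refine (norm_add_le _ _).trans ?_
    rw [norm_pow, norm_pow]
    linarith [pow_le_one₀ (n := r * (2 * r + 1)) (norm_nonneg q) hq,
      pow_le_one₀ (n := r * (2 * r - 1)) (norm_nonneg q) hq]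

/-! ### The double series, summed in two ways -/

/-- The double series which results from expanding `1 / (q;q)_{2n}`, with `n = r + m`. -/
noncomputable def doubleTerm (q : ℂ) (p : ℕ × ℕ) : ℂ :=
  baileyAlpha q p.1 * (qPoch (-1) (q ^ 2) (p.1 + p.2) * q ^ ((p.1 + p.2) ^ 2 + (p.1 + p.2))) *
    ((qPoch (q ^ 2) (q ^ 2) p.2)⁻¹ * (qPoch (q ^ 2) (q ^ 2) (p.1 + p.2 + p.1))⁻¹)

theorem summable_doubleTerm {q : ℂ} (hq : ‖q‖ < 1) : Summable (doubleTerm q) := by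
  have hq2 := norm_sq_lt_one hq
  obtain ⟨C, hC0, hC⟩ := exists_norm_qPoch_le (-1) hq2
  obtain ⟨D, hD0, hD⟩ := exists_norm_inv_qPoch_le hq2 hq2
  have hg := summable_geometric_of_lt_one (norm_nonneg q) hq
  have hgg := hg.mul_of_nonneg hg (fun _ => by positivity) (fun _ => by positivity)
  refine Summable.of_norm_bounded (g := fun p => 2 * (C * (‖q‖ ^ p.1 * ‖q‖ ^ p.2)) * (D * D))
    (((hgg.mul_left C).mul_left 2).mul_right _) fun p => ?_
  simp only [doubleTerm, norm_mul, norm_pow]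
  have hp : ‖q‖ ^ ((p.1 + p.2) ^ 2 + (p.1 + p.2)) ≤ ‖q‖ ^ p.1 * ‖q‖ ^ p.2 := by
    rw [← pow_add]
    exact pow_le_pow_of_le_one (norm_nonneg _) hq.le (Nat.le_add_left _ _)
  gcongr
  · exact norm_baileyAlpha_le hq.le _
  · exact hC _
  · exact hD _
  · exact hD _

theorem sum_antidiagonal_doubleTerm {q : ℂ} (hq : ‖q‖ < 1) (h0 : q ≠ 0) (n : ℕ) :
    ∑ p ∈ Finset.HasAntidiagonal.antidiagonal n, doubleTerm q p =
      qPoch (-1) (q ^ 2) n * q ^ (n ^ 2 + n) * (qPoch q q (2 * n))⁻¹ := by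
  rw [← sum_baileyAlpha hq h0, Finset.mul_sum,
    Finset.Nat.sum_antidiagonal_eq_sum_range_succ_mk]
  refine Finset.sum_congr rfl fun r hr => ?_
  have hr' : r ≤ n := Nat.lt_succ_iff.mp (Finset.mem_range.mp hr)
  simp only [doubleTerm, Nat.add_sub_cancel' hr']
  ring

/-- For r ≥ 1 the left side carries q^(3r²) (1 + q^(2r)), and (-1;q²)_r = 2 (-q²;q²)_{r-1} absorbs
the last factor. -/
theorem baileyAlpha_mul (q : ℂ) (r : ℕ) :
    baileyAlpha q r * q ^ (r ^ 2 + r) * qPoch (-1) (q ^ 2) r =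
      (if r = 0 then 1 else 2 * (q ^ 3) ^ (r ^ 2)) * qPoch (-q ^ 2) (q ^ 2) r := by
  rcases r with _ | r
  · simp [baileyAlpha, qPoch]
  · rw [qPoch_succ', qPoch_succ]
    simp only [baileyAlpha, if_neg (Nat.succ_ne_zero r), neg_one_mul,
      show 2 * (r + 1) - 1 = 2 * r + 1 by omega]
    ring

theorem hasSum_doubleTerm_fiber {q : ℂ} (hq : ‖q‖ < 1) (r : ℕ) :
    HasSum (fun m => doubleTerm q (r, m))
      ((if r = 0 then 1 else 2 * (q ^ 3) ^ (r ^ 2)) *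
        (qPochInf (-q ^ 2) (q ^ 2) / qPochInf (q ^ 2) (q ^ 2))) := by
  have hq2 := norm_sq_lt_one hq
  have hpow (k : ℕ) : ‖(q ^ 2) ^ (k + 1)‖ < 1 := by
    rw [norm_pow]; exact pow_lt_one₀ (norm_nonneg _) hq2 (Nat.succ_ne_zero k)
  -- With a = -q^(2r) and b = -q^(2r+2), the ₁φ₁ supplies the tails of (-1;q²)_{r+m} and
  -- (q²;q²)_{2r+m} beyond their first r and 2r factors.
  have hab : -(q ^ 2) ^ r * -(q ^ 2) ^ (r + 1) = (q ^ 2) ^ (2 * r + 1) := by ring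
  have h := (hasSum_phiTerm (a := -(q ^ 2) ^ r) (b := -(q ^ 2) ^ (r + 1)) hq2
    (by rw [norm_neg]; exact hpow r) (by rw [hab]; exact hpow _)).mul_left
    (baileyAlpha q r * q ^ (r ^ 2 + r) * qPoch (-1) (q ^ 2) r *
      (qPoch (q ^ 2) (q ^ 2) (2 * r))⁻¹)
  rw [hab] at h
  have hval : baileyAlpha q r * q ^ (r ^ 2 + r) * qPoch (-1) (q ^ 2) r *
      (qPoch (q ^ 2) (q ^ 2) (2 * r))⁻¹ *
      (qPochInf (-(q ^ 2) ^ (r + 1)) (q ^ 2) / qPochInf ((q ^ 2) ^ (2 * r + 1)) (q ^ 2)) =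
      (if r = 0 then 1 else 2 * (q ^ 3) ^ (r ^ 2)) *
        (qPochInf (-q ^ 2) (q ^ 2) / qPochInf (q ^ 2) (q ^ 2)) := by
    have n1 := qPochInf_ne_zero hq2 hq2
    rw [qPochInf_eq_mul _ hq2 (2 * r), ← pow_succ'] at n1
    rw [baileyAlpha_mul, qPochInf_eq_mul (-q ^ 2) hq2 r, qPochInf_eq_mul (q ^ 2) hq2 (2 * r),
      neg_mul, ← pow_succ', ← pow_succ']
    have n2 := left_ne_zero_of_mul n1
    have n3 := right_ne_zero_of_mul n1
    field_simp
  rw [hval] at h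
  refine h.congr_fun fun m => ?_
  have hm : 2 * m.choose 2 + m = m ^ 2 := by
    rw [Nat.choose_two_right, Nat.mul_div_cancel' (Nat.even_mul_pred_self m).two_dvd]
    rcases m with _ | m
    · rfl
    · simp; ring
  rw [doubleTerm, phiTerm, hab, show r + m + r = 2 * r + m by ring, qPoch_add, qPoch_add,
    neg_one_mul, neg_neg, ← pow_succ', mul_inv, div_eq_mul_inv, mul_inv,
    show (r + m) ^ 2 + (r + m) = (r ^ 2 + r) + (2 * ((r + 1) * m) + 2 * m.choose 2) by
      nlinarith [hm], pow_add q (r ^ 2 + r), pow_add q (2 * _), pow_mul q 2, pow_mul q 2,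
    pow_mul _ (r + 1) m]
  ring

theorem corollary2p5 (q : ℂ) (hq : ‖q‖ < 1) :
    HasSum
      (fun n : ℕ =>
        qPoch (-1) q (2 * n) * q ^ (n ^ 2 + n) /
          (qPoch (q ^ 2) (q ^ 2) n * qPoch (q ^ 2) (q ^ 4) n))
      (qPochInf (-q ^ 3) (q ^ 6) ^ 2 * qPochInf (q ^ 6) (q ^ 6) * qPochInf (-q ^ 2) (q ^ 2) /
        qPochInf (q ^ 2) (q ^ 2)) := by
  -- The finite identities use negative powers of q, so q = 0 is separate; there only n = 0
  -- contributes.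
  rcases eq_or_ne q 0 with rfl | h0
  · convert hasSum_single (f := fun n : ℕ => qPoch (-1) 0 (2 * n) * (0 : ℂ) ^ (n ^ 2 + n) /
      (qPoch (0 ^ 2) (0 ^ 2) n * qPoch (0 ^ 2) (0 ^ 4) n)) 0 ?_ using 1
    · simp [qPochInf, qPoch]
    · intro n hn
      simp [hn]
  · have hs := summable_doubleTerm hq
    have hq3 : ‖q ^ 3‖ < 1 := by
      rw [norm_pow]; exact pow_lt_one₀ (norm_nonneg _) hq three_ne_zero
    have h1 := hs.hasSum.prod_fiberwise (hasSum_doubleTerm_fiber hq)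
    have h2 := (hasSum_pow_sq hq3 (pow_ne_zero 3 h0)).mul_right
      (qPochInf (-q ^ 2) (q ^ 2) / qPochInf (q ^ 2) (q ^ 2))
    have h3 := hs.hasSum
    rw [h1.unique h2, ← pow_mul, ← mul_div_assoc] at h3
    -- Regrouping by r + m = n recovers the original series.
    have h4 := (Finset.HasAntidiagonal.sigmaAntidiagonalEquivProd.hasSum_iff.mpr h3).sigma
      fun n => hasSum_fintype _
    refine h4.congr_fun ?_
    intro n
    rw [qPoch_term_eq hq, ← sum_antidiagonal_doubleTerm hq h0]
    exact (Finset.sum_coe_sort (Finset.HasAntidiagonal.antidiagonal n) (doubleTerm q)).symm
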